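/- Let $n\ge 1$ and let $X$ be an $n$-dimensional complex Banach space with an absolute norm, that is, $X=(\mathbb C^n,\|\cdot\|)$ (up to a linear choice of coordinates) with $\|(a_1,\dots,a_n)\|=\|(|a_1|,\dots,|a_n|)\|$ for all $a_1,\dots,a_n\in\mathbb C$ and $\|e_1\|=\cdots=\|e_n\|=1$ for the canonical basis vectors $e_j$. For $k\ge 0$ and $Y=X$ or $Y=\mathbb C$, a $k$-homogeneous polynomial $P:X\to Y$ is a map of the form $P(x)=L(x,\dots,x)$ with $L:X^k\to Y$ continuous and $k$-linear (a constant, if $k=0$), and a polynomial is a finite sum of homogeneous polynomials. For a function $f$ bounded on the closed unit ball $B_X$ put $\|f\|=\sup_{x\in B_X}\|f(x)\|$, and for such $f$ with values in $X$ put $$v(f)=\sup\{|x^*(f(x))| : x\in X,\ x^*\in X^*,\ \|x\|=\|x^*\|=x^*(x)=1\}.$$ Define $n^{(k)}(X)=\inf\{v(P): P:X\to X \text{ a } k\text{-homogeneous polynomial},\ \|P\|=1\}$ and $n_a(X)=\inf\{v(P): P:X\to X\text{ a polynomial},\ \|P\|=1\}$. A polynomial $P:X\to X$ is weakly compact if $P(B_X)$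 is relatively weakly compact. The space $X$ has the alternative p-Daugavet property if $$\sup_{|\omega|=1}\|\mathrm{Id}+\omega P\|=1+\|P\|$$ for every weakly compact polynomial $P:X\to X$, and it has the $k$-order Daugavet property if $\|\mathrm{Id}+P\|=1+\|P\|$ for every polynomial of the form $P(x)=p(x)\,y$ with $y\in X$ and $p:X\to\mathbb C$ a $k$-homogeneous polynomial. Then the following are equivalent: - (a) $X$ has the alternative p-Daugavet property; - (b) $X$ has the $k$-order Daugavet property for some $k\ge 2$; - (b') $X$ has the $k$-order Daugavet property for every $k\ge 2$; - (c) $n^{(k)}(X)=1$ for some $k\ge 2$; - (c') $n^{(k)}(X)=1$ for every $k\ge 2$; - (d) $n_a(X)=1$; - (e) $X=\ell_\infty^n$, i.e. $\|(a_1,\dots,a_n)\|=\max_j|a_j|$ for all $(a_1,\dots,a_n)\in\mathbb C^n$; - (e') $X$ is linearly isometric to $\ell_\infty^n$. -/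

import Mathlib

open scoped BigOperators

noncomputable section

namespace PolyDaugavet

variable {X Y : Type*} [NormedAddCommGroup X] [NormedSpace ℂ X]
  [NormedAddCommGroup Y] [NormedSpace ℂ Y]

/-- The norm of `X`, transported to `ℂⁿ` by the coordinates `e`, is an absolute norm: it depends
only on the moduli of the coordinates, and the canonical basis vectors have norm one. -/
def IsAbsoluteNorm {n : ℕ} (e : (Fin n → ℂ) ≃ₗ[ℂ] X) : Prop :=
  (∀ a : Fin n → ℂ, ‖e a‖ = ‖e (fun i => ((‖a i‖ : ℝ) : ℂ))‖) ∧
    ∀ i : Fin n, ‖e (Pi.single i 1)‖ = 1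

/-- The continuous `k`-homogeneous polynomials `X → Y`: diagonals of continuous `k`-linear maps
(for `k = 0` these are the constants). -/
def IsHomogeneousPolynomial (k : ℕ) (P : X → Y) : Prop :=
  ∃ L : ContinuousMultilinearMap ℂ (fun _ : Fin k => X) Y, ∀ x, P x = L (fun _ => x)

/-- The continuous polynomials `X → Y`: finite sums of homogeneous polynomials. -/
def IsPolynomial (P : X → Y) : Prop :=
  ∃ (N : ℕ) (Q : ℕ → X → Y), (∀ k, IsHomogeneousPolynomial k (Q k)) ∧
    ∀ x, P x = ∑ k ∈ Finset.range N, Q k x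

/-- The supremum norm on the closed unit ball of `X`, for maps bounded there. -/
def ballNorm (f : X → Y) : ℝ :=
  ⨆ x : Metric.closedBall (0 : X) 1, ‖f x‖

/-- The numerical radius `v(f) = sup {|x*(f x)| : ‖x‖ = ‖x*‖ = x*(x) = 1}`. -/
def numericalRadius (f : X → X) : ℝ :=
  sSup {r : ℝ | ∃ (x : X) (φ : X →L[ℂ] ℂ), ‖x‖ = 1 ∧ ‖φ‖ = 1 ∧ φ x = 1 ∧ r = ‖φ (f x)‖}

variable (X)

/-- The `k`-polynomial numerical index `n^(k)(X)`. -/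
def polynomialNumericalIndex (k : ℕ) : ℝ :=
  sInf {r : ℝ | ∃ P : X → X, IsHomogeneousPolynomial k P ∧ ballNorm P = 1 ∧
    r = numericalRadius P}

/-- The analytic numerical index `n_a(X)`. -/
def analyticNumericalIndex : ℝ :=
  sInf {r : ℝ | ∃ P : X → X, IsPolynomial P ∧ ballNorm P = 1 ∧ r = numericalRadius P}

variable {X}

/-- The Daugavet equation `‖Id + Φ‖ = 1 + ‖Φ‖`. -/
def DaugavetEquation (Φ : X → X) : Prop :=
  ballNorm (fun x => x + Φ x) = 1 + ballNorm Φ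

/-- The alternative Daugavet equation `sup_{|ω| = 1} ‖Id + ω Φ‖ = 1 + ‖Φ‖`. -/
def AlternativeDaugavetEquation (Φ : X → X) : Prop :=
  (⨆ ω : Metric.sphere (0 : ℂ) 1, ballNorm (fun x => x + (ω : ℂ) • Φ x)) = 1 + ballNorm Φ

/-- The map sends the closed unit ball to a relatively weakly compact set. -/
def IsWeaklyCompactMap (Φ : X → Y) : Prop :=
  IsCompact (closure (toWeakSpace ℂ Y '' (Φ '' Metric.closedBall (0 : X) 1)))

variable (X)

/-- The alternative p-Daugavet property. -/
def AlternativePDaugavetProperty : Prop :=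
  ∀ P : X → X, IsPolynomial P → IsWeaklyCompactMap P → AlternativeDaugavetEquation P

/-- The `k`-order Daugavet property: the Daugavet equation holds for every rank-one
`k`-homogeneous polynomial `x ↦ p(x) y`, with `p` a scalar `k`-homogeneous polynomial. -/
def OrderDaugavetProperty (k : ℕ) : Prop :=
  ∀ (p : X → ℂ) (y : X), IsHomogeneousPolynomial k p → DaugavetEquation (fun x => p x • y)

end PolyDaugavet

end

/-! Each of (a), (b), (c), (d) says that a normalized rank-one polynomial `p · y` of degree `k ≥ 2`
(`k = 2` for (a) and (d)) satisfies `‖x + ω p(x) y‖ ≥ 2` for some `x` in the unit ball and some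
unimodular `ω`; compactness provides attainment. This forces `|p x| = 1`. Let `u` be a point of the
ball with positive coordinates and maximal product of coordinates. `exists_peak_polynomial` makes
`p` peak only at unimodular multiples of `u`, so every unit vector `y` satisfies `‖u + ωy‖ ≥ 2` for
some unimodular `ω`.

Take `y` proportional to `(1, ζ, …, ζ^(n-1))` with `ζ` a primitive `n`-th root of unity. A
functional norming `u + ωy` norms both summands: the first makes its coefficients nonnegative, the
second confines them to a single index. Hence `‖(1, …, 1)‖ ≤ 1`, and monotonicity gives the sup norm
(`norm_one_le_of_positive`, `norm_eq_of_norm_one_le`).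

Conversely, on `ℓ_∞^n` the maximum modulus principle in one coordinate moves the point where a
coordinate of `P` is largest to a point whose same coordinate is unimodular
(`exists_coord_eq_ballNorm`). The converse uses only an isometry onto `ℓ_∞^n`, so (e') suffices. -/

namespace PolyDaugavet

/-! ### Absolute norms, an extremal positive vector, and a criterion for the sup norm. -/

section AbsoluteNorm

variable {X : Type*} [NormedAddCommGroup X] [NormedSpace ℂ X] {n : ℕ}
  {e : (Fin n → ℂ) ≃ₗ[ℂ] X}

lemma IsAbsoluteNorm.norm_congr (he : IsAbsoluteNorm e) {a b : Fin n → ℂ}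
    (h : ∀ i, ‖a i‖ = ‖b i‖) : ‖e a‖ = ‖e b‖ := by
  rw [he.1 a, he.1 b]
  simp only [h]

/-- An absolute norm is monotone in the moduli of the coordinates. -/
lemma IsAbsoluteNorm.norm_mono (he : IsAbsoluteNorm e) {a b : Fin n → ℂ}
    (h : ∀ i, ‖a i‖ ≤ ‖b i‖) : ‖e a‖ ≤ ‖e b‖ := by
  -- `|aᵢ|` is the midpoint of two conjugate numbers of modulus `|bᵢ|`, so the vector of moduli of
  -- `a` averages two vectors of norm `‖e b‖`.
  let v : Fin n → ℂ := fun i => ⟨‖a i‖, Real.sqrt (‖b i‖ ^ 2 - ‖a i‖ ^ 2)⟩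
  let w : Fin n → ℂ := fun i => ⟨‖a i‖, -Real.sqrt (‖b i‖ ^ 2 - ‖a i‖ ^ 2)⟩
  have hs : ∀ i, Real.sqrt (‖b i‖ ^ 2 - ‖a i‖ ^ 2) ^ 2 = ‖b i‖ ^ 2 - ‖a i‖ ^ 2 := fun i =>
    Real.sq_sqrt (sub_nonneg.2 (pow_le_pow_left₀ (norm_nonneg _) (h i) 2))
  have hv : ∀ i, ‖v i‖ = ‖b i‖ := fun i => by
    rw [← sq_eq_sq₀ (norm_nonneg _) (norm_nonneg _), Complex.sq_norm, Complex.normSq_mk]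
    linarith [hs i]
  have hw : ∀ i, ‖w i‖ = ‖b i‖ := fun i => by
    rw [← sq_eq_sq₀ (norm_nonneg _) (norm_nonneg _), Complex.sq_norm, Complex.normSq_mk]
    linarith [hs i]
  have hsum : (2 : ℂ) • e (fun i => ((‖a i‖ : ℝ) : ℂ)) = e v + e w := by
    rw [← map_add, ← map_smul]
    congr 1
    ext i
    apply Complex.ext
    · simp [v, w]; ring
    · simp [v, w]
  have h2 : ‖(2 : ℂ) • e (fun i => ((‖a i‖ : ℝ) : ℂ))‖ ≤ ‖e v‖ + ‖e w‖ :=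
    hsum ▸ norm_add_le _ _
  rw [norm_smul, ← he.1 a, he.norm_congr hv, he.norm_congr hw, Complex.norm_ofNat] at h2
  linarith

lemma IsAbsoluteNorm.norm_single (he : IsAbsoluteNorm e) (i : Fin n) (c : ℂ) :
    ‖e (Pi.single i c)‖ = ‖c‖ := by
  have : Pi.single i c = c • (Pi.single i 1 : Fin n → ℂ) := by
    rw [← Pi.single_smul]; simp
  rw [this, map_smul, norm_smul, he.2 i, mul_one]

lemma IsAbsoluteNorm.norm_coord_le (he : IsAbsoluteNorm e) (a : Fin n → ℂ) (i : Fin n) :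
    ‖a i‖ ≤ ‖e a‖ := by
  rw [← he.norm_single i (a i)]
  refine he.norm_mono fun j => ?_
  by_cases h : j = i
  · subst h; simp
  · simp [Pi.single_eq_of_ne h]

/-- An absolute norm in which the vector `(1, …, 1)` lies in the unit ball is the sup norm. -/
lemma IsAbsoluteNorm.norm_eq_of_norm_one_le (he : IsAbsoluteNorm e)
    (h1 : ‖e (fun _ => 1)‖ ≤ 1) (a : Fin n → ℂ) : ‖e a‖ = ‖a‖ := by
  refine le_antisymm ?_ ((pi_norm_le_iff_of_nonneg (norm_nonneg _)).2 (he.norm_coord_le a))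
  calc ‖e a‖ ≤ ‖e ((‖a‖ : ℂ) • (fun _ => (1 : ℂ)))‖ :=
        he.norm_mono fun i => by simpa using norm_le_pi_norm a i
    _ = ‖a‖ * ‖e (fun _ => 1)‖ := by rw [map_smul, norm_smul]; simp
    _ ≤ ‖a‖ := mul_le_of_le_one_right (norm_nonneg _) h1

/-- If `∏ (1 + t cᵢ) ≤ 1` for small `t ≥ 0` then `∑ cᵢ ≤ 0`. -/
lemma sum_nonpos_of_prod_one_add_le_one {ι : Type*} [Fintype ι] (c : ι → ℝ)
    (h : ∀ t : ℝ, 0 ≤ t → t ≤ 1 → ∏ i, (1 + t * c i) ≤ 1) : ∑ i, c i ≤ 0 := by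
  classical
  -- The product equals 1 at `t = 0`, so the right slopes there are nonpositive.
  have hd : HasDerivAt (fun t : ℝ => ∏ i, (1 + t * c i)) (∑ i, c i) 0 := by
    have := HasDerivAt.fun_finsetProd (u := Finset.univ) (x := (0 : ℝ))
      (f := fun i t => 1 + t * c i) (f' := c)
      (fun i _ => by simpa using ((hasDerivAt_id (0 : ℝ)).mul_const (c i)).const_add 1)
    simpa using this
  have hd' := hasDerivWithinAt_iff_tendsto_slope.1 (hd.hasDerivWithinAt (s := Set.Ioi 0))
  rw [Set.sdiff_singleton_eq_self (by simp)] at hd'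
  refine le_of_tendsto hd' ?_
  have : Set.Ioc (0 : ℝ) 1 ∈ nhdsWithin (0 : ℝ) (Set.Ioi 0) := Ioc_mem_nhdsGT one_pos
  filter_upwards [this] with t ht
  rw [slope_def_field]
  refine div_nonpos_of_nonpos_of_nonneg ?_ (by linarith [ht.1])
  simpa using h t ht.1.le ht.2

/-- A point of the unit ball of an absolute norm maximizing the product of the moduli of the
coordinates: the weights given by its reciprocals define a supporting functional. -/
lemma IsAbsoluteNorm.exists_extremal (he : IsAbsoluteNorm e) :
    ∃ u : Fin n → ℝ, (∀ i, 0 < u i) ∧ ‖e (fun i => (u i : ℂ))‖ ≤ 1 ∧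
      ∀ a : Fin n → ℂ, ‖e a‖ ≤ 1 → ∑ i, ‖a i‖ / u i ≤ n := by
  have hec : Continuous e := e.toLinearMap.continuous_of_finiteDimensional
  let K : Set (Fin n → ℂ) := {a | ‖e a‖ ≤ 1}
  have hK : IsCompact K := by
    refine (isCompact_closedBall (0 : Fin n → ℂ) 1).of_isClosed_subset
      (isClosed_le hec.norm continuous_const) fun a ha => ?_
    rw [mem_closedBall_zero_iff]
    exact (pi_norm_le_iff_of_nonneg zero_le_one).2 fun i => (he.norm_coord_le a i).trans ha
  obtain ⟨w, hwK, hw⟩ := hK.exists_isMaxOn ⟨0, by simp [K]⟩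
    (f := fun a : Fin n → ℂ => ∏ i, ‖a i‖) (by fun_prop)
  -- A small multiple of `(1, …, 1)` lies in the ball and has positive product.
  have hpos : 0 < ∏ i, ‖w i‖ := by
    let R : ℝ := ‖e (fun _ => 1)‖ + 1
    have hR : 0 < R := by positivity
    have hmem : ((R⁻¹ : ℝ) : ℂ) • (fun _ => 1 : Fin n → ℂ) ∈ K := by
      simp only [K, Set.mem_ofPred_eq, map_smul, norm_smul, Complex.norm_real, norm_inv,
        Real.norm_of_nonneg hR.le]
      rw [inv_mul_le_one₀ hR]
      simp [R]
    refine lt_of_lt_of_le ?_ (hw hmem)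
    refine Finset.prod_pos fun i _ => ?_
    simp [hR.ne']
  have hwpos : ∀ i, 0 < ‖w i‖ := fun i => (norm_nonneg _).lt_of_ne' fun h =>
    hpos.ne' (Finset.prod_eq_zero (Finset.mem_univ i) h)
  refine ⟨fun i => ‖w i‖, hwpos, ?_, fun a ha => ?_⟩
  · rw [← he.1]; exact hwK
  have key : ∑ i, (‖a i‖ / ‖w i‖ - 1) ≤ 0 := by
    refine sum_nonpos_of_prod_one_add_le_one _ fun t ht0 ht1 => ?_
    -- By convexity the segment from `|w|` to `|a|` stays in `K`; the ratio of its product to that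
    -- of `w` is `∏ (1 + t(|aᵢ|/|wᵢ| - 1))`.
    let b : Fin n → ℂ := ((1 - t : ℝ) : ℂ) • (fun i => ((‖w i‖ : ℝ) : ℂ)) +
      (t : ℂ) • (fun i => ((‖a i‖ : ℝ) : ℂ))
    have hb : b ∈ K := by
      change ‖e b‖ ≤ 1
      rw [map_add, map_smul, map_smul]
      refine (norm_add_le _ _).trans ?_
      rw [norm_smul, norm_smul, ← he.1, ← he.1, Complex.norm_real, Complex.norm_real,
        Real.norm_of_nonneg ht0, Real.norm_of_nonneg (by linarith)]
      have : ‖e w‖ ≤ 1 := hwK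
      nlinarith
    have hbi : ∀ i, ‖b i‖ = ‖w i‖ * (1 + t * (‖a i‖ / ‖w i‖ - 1)) := fun i => by
      have h1 : b i = (((1 - t) * ‖w i‖ + t * ‖a i‖ : ℝ) : ℂ) := by simp [b]
      rw [h1, Complex.norm_real, Real.norm_of_nonneg
        (add_nonneg (mul_nonneg (by linarith) (norm_nonneg _)) (mul_nonneg ht0 (norm_nonneg _)))]
      field_simp [(hwpos i).ne']
      ring
    have := hw hb
    simp only [Set.mem_ofPred_eq, hbi, Finset.prod_mul_distrib] at this
    exact le_of_mul_le_mul_left (by simpa using this) hpos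
  simpa using key

/-- If a strictly positive vector `u` of the unit ball satisfies `‖u + ωy‖ = 2` for all unit
vectors `y` and suitable unimodular `ω`, then `(1, …, 1)` lies in the unit ball. -/
lemma IsAbsoluteNorm.norm_one_le_of_positive (he : IsAbsoluteNorm e) (hn : 1 ≤ n)
    {u : Fin n → ℝ} (hu : ∀ i, 0 < u i) (hu1 : ‖e (fun i => (u i : ℂ))‖ ≤ 1)
    (h : ∀ y : X, ‖y‖ = 1 → ∃ ω : ℂ, ‖ω‖ = 1 ∧ 2 ≤ ‖e (fun i => (u i : ℂ)) + ω • y‖) :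
    ‖e (fun _ => 1)‖ ≤ 1 := by
  let ζ : ℂ := Complex.exp (2 * Real.pi * Complex.I / n)
  have hζ : IsPrimitiveRoot ζ n := Complex.isPrimitiveRoot_exp n (by omega)
  have hζ1 : ‖ζ‖ = 1 := hζ.norm'_eq_one (by omega)
  -- Only unimodularity and pairwise distinctness of the entries matter.
  let ε : Fin n → ℂ := fun i => ζ ^ (i : ℕ)
  have hε1 : ∀ i, ‖ε i‖ = 1 := fun i => by simp [ε, hζ1]
  have hεinj : ∀ i j, ε i = ε j → i = j := fun i j hij => Fin.ext (hζ.pow_inj i.2 j.2 hij)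
  set R : ℝ := ‖e (fun _ => 1)‖ with hR
  have hRpos : 0 < R := by
    have := he.norm_coord_le (fun _ => 1) ⟨0, hn⟩
    rw [norm_one] at this
    exact zero_lt_one.trans_le this
  have hεR : ‖e ε‖ = R := he.norm_congr fun i => by simp [hε1]
  set y := ((R⁻¹ : ℝ) : ℂ) • e ε with hy
  have hy1 : ‖y‖ = 1 := by
    rw [hy, norm_smul, hεR, Complex.norm_real, norm_inv, Real.norm_of_nonneg hRpos.le,
      inv_mul_cancel₀ hRpos.ne']
  obtain ⟨ω, hω, h2⟩ := h y hy1
  -- `ψ` reaches 2 or more on a sum of two vectors of norm at most 1, so its real part is 1 on each.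
  obtain ⟨ψ, hψ, hψv⟩ := exists_dual_vector ℂ (e (fun i => (u i : ℂ)) + ω • y) (by linarith)
  have hψle : ∀ x : X, ‖ψ x‖ ≤ ‖x‖ := fun x => by simpa [hψ] using ψ.le_opNorm x
  let c : Fin n → ℂ := fun i => ψ (e (Pi.single i 1))
  have hc : ∀ a : Fin n → ℂ, ψ (e a) = ∑ i, a i * c i := fun a => by
    conv_lhs => rw [← Finset.univ_sum_single a]
    rw [map_sum, map_sum]
    refine Finset.sum_congr rfl fun i _ => ?_
    have : Pi.single i (a i) = a i • (Pi.single i 1 : Fin n → ℂ) := by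
      rw [← Pi.single_smul]; simp
    rw [this, map_smul, map_smul, smul_eq_mul]
  have hc1 : ∀ i, ‖c i‖ ≤ 1 := fun i => (hψle _).trans (he.2 i).le
  have hre : (ψ (e (fun i => (u i : ℂ)))).re + (ψ (ω • y)).re =
      ‖e (fun i => (u i : ℂ)) + ω • y‖ := by
    rw [← Complex.add_re, ← map_add, hψv]; exact Complex.ofReal_re _
  have hA : (ψ (e (fun i => (u i : ℂ)))).re ≤ 1 :=
    (Complex.re_le_norm _).trans ((hψle _).trans hu1)
  have hB : (ψ (ω • y)).re ≤ 1 :=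
    (Complex.re_le_norm _).trans ((hψle _).trans (by rw [norm_smul, hω, hy1, one_mul]))
  have hA1 : 1 ≤ (ψ (e (fun i => (u i : ℂ)))).re := by linarith
  have hB1 : 1 ≤ (ψ (ω • y)).re := by linarith
  -- the coefficients of `ψ` are nonnegative
  have hcnn : ∀ i, c i = (‖c i‖ : ℂ) := by
    have hθ : ∀ z : ℂ, ∃ θ : ℂ, ‖θ‖ = 1 ∧ θ * z = (‖z‖ : ℂ) := fun z => by
      by_cases hz : z = 0
      · exact ⟨1, by simp, by simp [hz]⟩
      · have hz' : (‖z‖ : ℂ) ≠ 0 := by simpa using hz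
        exact ⟨‖z‖ / z, by simp [hz], by field_simp⟩
    choose θ hθ1 hθ2 using hθ
    -- Rotating the coordinates of `u` by `θ (c i)` preserves an absolute norm. Against `∑ uᵢ Re cᵢ
    -- ≥ 1`, this forces `Re cᵢ = |cᵢ|` because `uᵢ > 0`.
    have hle : ∑ i, u i * ‖c i‖ ≤ 1 := by
      have h3 : ψ (e (fun i => (u i : ℂ) * θ (c i))) = ((∑ i, u i * ‖c i‖ : ℝ) : ℂ) := by
        rw [hc]; push_cast
        exact Finset.sum_congr rfl fun i _ => by rw [mul_assoc, hθ2]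
      have h4 := hψle (e (fun i => (u i : ℂ) * θ (c i)))
      rw [h3, Complex.norm_real, he.norm_congr (b := fun i => (u i : ℂ))
        (fun i => by simp [hθ1])] at h4
      exact (le_abs_self _).trans (h4.trans hu1)
    have hge : 1 ≤ ∑ i, u i * (c i).re := by
      rw [hc, Complex.re_sum] at hA1
      simpa using hA1
    have hsum : ∑ i, u i * (‖c i‖ - (c i).re) = 0 := by
      refine le_antisymm ?_ (Finset.sum_nonneg fun i _ =>
        mul_nonneg (hu i).le (sub_nonneg.2 (Complex.re_le_norm _)))
      simp only [mul_sub, Finset.sum_sub_distrib]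
      linarith
    intro i
    have h5 := (Finset.sum_eq_zero_iff_of_nonneg fun i _ =>
      mul_nonneg (hu i).le (sub_nonneg.2 (Complex.re_le_norm (c i)))).1 hsum i (Finset.mem_univ i)
    have h6 : (c i).re = ‖c i‖ := by
      rcases mul_eq_zero.1 h5 with h | h
      · exact absurd h (hu i).ne'
      · linarith
    exact Complex.eq_coe_norm_of_nonneg (Complex.re_eq_norm.1 h6)
  have hsumR : ∑ i, ‖c i‖ ≤ R := by
    have h3 : ψ (e (fun _ => 1)) = ((∑ i, ‖c i‖ : ℝ) : ℂ) := by
      rw [hc]; push_cast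
      exact Finset.sum_congr rfl fun i _ => by rw [one_mul, ← hcnn]
    have h4 := hψle (e (fun _ => 1))
    rw [h3, Complex.norm_real] at h4
    exact (le_abs_self _).trans h4
  have hReR : R ≤ ∑ i, ‖c i‖ * (ω * ε i).re := by
    have h3 : ψ (ω • y) = ((R⁻¹ : ℝ) : ℂ) * ∑ i, ω * ε i * c i := by
      rw [hy, map_smul, map_smul, hc, smul_eq_mul, smul_eq_mul, mul_left_comm, Finset.mul_sum]
      simp only [mul_assoc]
    have h4 : (∑ i, ω * ε i * c i).re = ∑ i, ‖c i‖ * (ω * ε i).re := by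
      rw [Complex.re_sum]
      refine Finset.sum_congr rfl fun i _ => ?_
      conv_lhs => rw [hcnn i]
      rw [mul_comm, Complex.re_ofReal_mul]
    rw [h3, Complex.re_ofReal_mul, h4, inv_mul_eq_div, one_le_div hRpos] at hB1
    exact hB1
  have hωε : ∀ i, (ω * ε i).re ≤ 1 := fun i =>
    (Complex.re_le_norm _).trans (by rw [norm_mul, hω, hε1, one_mul])
  -- Equality throughout `R ≤ ∑ |cᵢ| Re(ωεᵢ) ≤ ∑ |cᵢ| ≤ R`.
  have hsum : ∑ i, ‖c i‖ * (1 - (ω * ε i).re) = 0 := by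
    refine le_antisymm ?_ (Finset.sum_nonneg fun i _ =>
      mul_nonneg (norm_nonneg _) (sub_nonneg.2 (hωε i)))
    simp only [mul_sub, mul_one, Finset.sum_sub_distrib]
    linarith
  have hone : ∀ i, c i ≠ 0 → ω * ε i = 1 := fun i hi => by
    have h5 := (Finset.sum_eq_zero_iff_of_nonneg fun i _ =>
      mul_nonneg (norm_nonneg _) (sub_nonneg.2 (hωε i))).1 hsum i (Finset.mem_univ i)
    have h6 : (ω * ε i).re = 1 := by
      rcases mul_eq_zero.1 h5 with h | h
      · exact absurd (norm_eq_zero.1 h) hi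
      · linarith
    have h7 : ‖ω * ε i‖ = 1 := by rw [norm_mul, hω, hε1, one_mul]
    have h8 : ω * ε i = (‖ω * ε i‖ : ℂ) :=
      Complex.eq_coe_norm_of_nonneg (Complex.re_eq_norm.1 (h6.trans h7.symm))
    rw [h8, h7, Complex.ofReal_one]
  have hω0 : ω ≠ 0 := by rintro rfl; simp at hω
  obtain ⟨j, hj⟩ : ∃ j, c j ≠ 0 := by
    by_contra! hall
    simp [hall] at hReR
    linarith
  have honly : ∀ i, i ≠ j → c i = 0 := fun i hij => by
    by_contra hi
    exact hij (hεinj i j (mul_left_cancel₀ hω0 ((hone i hi).trans (hone j hj).symm)))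
  rw [Finset.sum_eq_single j (fun i _ hij => by simp [honly i hij]) (by simp), hone j hj] at hReR
  simp only [Complex.one_re, mul_one] at hReR
  exact hReR.trans (hc1 j)

end AbsoluteNorm

/-! ### A quadratic form with a strict peak on the `ℓ₁`-ball. -/

section PeakPolynomial

/-- With `s = ∑ zᵢ`, the form is `s² + ∑ zᵢ(s - zᵢ)`, whose second term has no diagonal part. A bare
power of `s` peaks at many points of the `ℓ₁`-ball; the correction `-∑ zᵢ²` penalizes unequal
moduli. -/
lemma norm_quadratic_le {n : ℕ} (z : Fin n → ℂ) :
    ‖2 * (∑ i, z i) ^ 2 - ∑ i, z i ^ 2‖ ≤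
      ‖∑ i, z i‖ ^ 2 + (∑ i, ‖z i‖) ^ 2 - ∑ i, ‖z i‖ ^ 2 := by
  have h1 : 2 * (∑ i, z i) ^ 2 - ∑ i, z i ^ 2 =
      (∑ i, z i) ^ 2 + ∑ i, z i * (∑ j, z j - z i) := by
    simp only [mul_sub, Finset.sum_sub_distrib, ← Finset.sum_mul, ← sq]
    ring
  have h2 : ∀ i, ‖z i * (∑ j, z j - z i)‖ ≤ ‖z i‖ * (∑ j, ‖z j‖ - ‖z i‖) := fun i => by
    rw [norm_mul]
    refine mul_le_mul_of_nonneg_left ?_ (norm_nonneg _)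
    rw [← Finset.sum_erase_eq_sub (Finset.mem_univ i), ← Finset.sum_erase_eq_sub (Finset.mem_univ i)]
    exact norm_sum_le _ _
  have h3 : ∑ i, ‖z i‖ * (∑ j, ‖z j‖ - ‖z i‖) = (∑ i, ‖z i‖) ^ 2 - ∑ i, ‖z i‖ ^ 2 := by
    simp only [mul_sub, Finset.sum_sub_distrib, ← Finset.sum_mul, ← sq]
  rw [h1]
  refine (norm_add_le _ _).trans ?_
  rw [norm_pow, add_sub_assoc, ← h3]
  exact add_le_add_right ((norm_sum_le _ _).trans (Finset.sum_le_sum fun i _ => h2 i)) _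

/-- Cauchy–Schwarz bounds `(∑ |zᵢ|)² - ∑ |zᵢ|²` by `n² - n`. The bound is the value at `(1, …, 1)`.
-/
lemma norm_quadratic_le_const {n : ℕ} (hn : 1 ≤ n) (z : Fin n → ℂ) (hz : ∑ i, ‖z i‖ ≤ n) :
    ‖2 * (∑ i, z i) ^ 2 - ∑ i, z i ^ 2‖ ≤ 2 * (n : ℝ) ^ 2 - n := by
  have h1 := norm_quadratic_le z
  have h2 : (∑ i, ‖z i‖) ^ 2 ≤ n * ∑ i, ‖z i‖ ^ 2 := by
    simpa using sq_sum_le_card_mul_sum_sq (s := Finset.univ) (f := fun i => ‖z i‖)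
  have h3 : ‖∑ i, z i‖ ≤ ∑ i, ‖z i‖ := norm_sum_le _ _
  have h0 := norm_nonneg (∑ i, z i)
  set s := ‖∑ i, z i‖
  set T := ∑ i, ‖z i‖
  set S := ∑ i, ‖z i‖ ^ 2
  have hn' : (1 : ℝ) ≤ n := by exact_mod_cast hn
  have hs : s ^ 2 ≤ n ^ 2 := by nlinarith
  have hT : T ^ 2 ≤ n ^ 2 := by nlinarith
  have h4 : (n : ℝ) * (T ^ 2 - S) ≤ n * (n ^ 2 - n) := by nlinarith
  have h5 := le_of_mul_le_mul_left h4 (by linarith)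
  linarith

/-- The quadratic form `2 (∑ zᵢ)² - ∑ zᵢ²`, times a power of `∑ zᵢ`, peaks on the `ℓ₁`-ball of
radius `n` only at the unimodular multiples of `(1, …, 1)`. -/
lemma eq_const_of_quadratic_peak {n : ℕ} (hn : 1 ≤ n) (m : ℕ) (z : Fin n → ℂ)
    (hz : ∑ i, ‖z i‖ ≤ n)
    (h : ‖2 * (∑ i, z i) ^ 2 - ∑ i, z i ^ 2‖ * ‖∑ i, z i‖ ^ m = (2 * (n : ℝ) ^ 2 - n) * n ^ m) :
    ∃ ω : ℂ, ‖ω‖ = 1 ∧ ∀ i, z i = ω := by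
  have h1 := norm_quadratic_le z
  have hc := norm_quadratic_le_const hn z hz
  have h2 : (∑ i, ‖z i‖) ^ 2 ≤ n * ∑ i, ‖z i‖ ^ 2 := by
    simpa using sq_sum_le_card_mul_sum_sq (s := Finset.univ) (f := fun i => ‖z i‖)
  have h3 : ‖∑ i, z i‖ ≤ ∑ i, ‖z i‖ := norm_sum_le _ _
  have h0 := norm_nonneg (∑ i, z i)
  have hn' : (1 : ℝ) ≤ n := by exact_mod_cast hn
  have hm : ‖∑ i, z i‖ ^ m ≤ (n : ℝ) ^ m := pow_le_pow_left₀ h0 (h3.trans hz) m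
  -- The linear factor is at most `n^m`, so the quadratic factor must itself be maximal.
  have hq : 2 * (n : ℝ) ^ 2 - n ≤ ‖2 * (∑ i, z i) ^ 2 - ∑ i, z i ^ 2‖ := by
    have hnm : (0 : ℝ) < n ^ m := by positivity
    refine le_of_mul_le_mul_right ?_ hnm
    rw [← h]
    exact mul_le_mul_of_nonneg_left hm (norm_nonneg _)
  have hs : ‖∑ i, z i‖ = n ∧ ∑ i, ‖z i‖ ^ 2 ≤ n := by
    set s := ‖∑ i, z i‖
    set T := ∑ i, ‖z i‖
    set S := ∑ i, ‖z i‖ ^ 2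
    have hs2 : s ^ 2 ≤ n ^ 2 := by nlinarith
    have hT2 : T ^ 2 ≤ n ^ 2 := by nlinarith
    have h4 : (n : ℝ) * (T ^ 2 - S) ≤ n * (n ^ 2 - n) := by nlinarith
    have h5 := le_of_mul_le_mul_left h4 (by linarith)
    have h6 : s ^ 2 = n ^ 2 := by linarith
    refine ⟨?_, by linarith⟩
    exact (sq_eq_sq₀ h0 (by linarith)).1 h6
  obtain ⟨hs, hS⟩ := hs
  have hn0 : (n : ℂ) ≠ 0 := by exact_mod_cast (by omega : n ≠ 0)
  have hω1 : ‖(∑ i, z i) / n‖ = 1 := by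
    rw [norm_div, hs, Complex.norm_natCast, div_self (by linarith)]
  refine ⟨(∑ i, z i) / n, hω1, ?_⟩
  set ω := (∑ i, z i) / n with hω
  have hsω : ∑ i, z i = n * ω := by rw [hω]; field_simp
  have hnorm : ∀ i, ‖z i - ω‖ ^ 2 = ‖z i‖ ^ 2 - 2 * (z i * (starRingEnd ℂ) ω).re + 1 := fun i => by
    rw [Complex.sq_norm, Complex.normSq_sub, ← Complex.sq_norm, ← Complex.sq_norm, hω1]
    ring
  -- With `ω` the mean, the sum is `∑ |zᵢ|² - 2n + n ≤ 0`.
  have hsum : ∑ i, ‖z i - ω‖ ^ 2 = 0 := by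
    refine le_antisymm ?_ (Finset.sum_nonneg fun i _ => sq_nonneg _)
    have h7 : ∑ i, (z i * (starRingEnd ℂ) ω).re = n := by
      rw [← Complex.re_sum, ← Finset.sum_mul, hsω, mul_assoc, Complex.mul_conj,
        Complex.normSq_eq_norm_sq, hω1]
      simp
    simp only [hnorm, Finset.sum_add_distrib, Finset.sum_sub_distrib, ← Finset.mul_sum, h7]
    simp
    linarith
  intro i
  have := (Finset.sum_eq_zero_iff_of_nonneg fun i _ => sq_nonneg _).1 hsum i (Finset.mem_univ i)
  exact sub_eq_zero.1 (norm_eq_zero.1 (pow_eq_zero_iff two_ne_zero |>.1 this))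

end PeakPolynomial

/-! ### Closure and regularity properties of homogeneous polynomials. -/

section Homogeneous

variable {X Y : Type*} [NormedAddCommGroup X] [NormedSpace ℂ X]
  [NormedAddCommGroup Y] [NormedSpace ℂ Y] {k : ℕ}

lemma IsHomogeneousPolynomial.prod_linear (f : Fin k → X →L[ℂ] ℂ) :
    IsHomogeneousPolynomial k (fun x => ∏ i, f i x) :=
  ⟨(ContinuousMultilinearMap.mkPiAlgebra ℂ (Fin k) ℂ).compContinuousLinearMap f, fun x => by simp⟩

lemma IsHomogeneousPolynomial.zero : IsHomogeneousPolynomial k (fun _ : X => (0 : Y)) :=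
  ⟨0, fun _ => rfl⟩

lemma IsHomogeneousPolynomial.add {P Q : X → Y} (hP : IsHomogeneousPolynomial k P)
    (hQ : IsHomogeneousPolynomial k Q) : IsHomogeneousPolynomial k (fun x => P x + Q x) := by
  obtain ⟨L, hL⟩ := hP
  obtain ⟨M, hM⟩ := hQ
  exact ⟨L + M, fun x => by simp [hL, hM]⟩

lemma IsHomogeneousPolynomial.const_smul (c : ℂ) {P : X → Y}
    (hP : IsHomogeneousPolynomial k P) : IsHomogeneousPolynomial k (fun x => c • P x) := by
  obtain ⟨L, hL⟩ := hP
  exact ⟨c • L, fun x => by simp [hL]⟩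

lemma IsHomogeneousPolynomial.sum {ι : Type*} (s : Finset ι) {P : ι → X → Y}
    (hP : ∀ i, IsHomogeneousPolynomial k (P i)) :
    IsHomogeneousPolynomial k (fun x => ∑ i ∈ s, P i x) := by
  choose L hL using hP
  exact ⟨∑ i ∈ s, L i, fun x => by simp [hL]⟩

lemma IsHomogeneousPolynomial.smul_const {p : X → ℂ} (hp : IsHomogeneousPolynomial k p) (y : Y) :
    IsHomogeneousPolynomial k (fun x => p x • y) := by
  obtain ⟨L, hL⟩ := hp
  exact ⟨(ContinuousLinearMap.toSpanSingleton ℂ y).compContinuousMultilinearMap L,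
    fun x => by simp [hL]⟩

lemma IsHomogeneousPolynomial.mul_pow {m : ℕ} (f g : X →L[ℂ] ℂ) :
    IsHomogeneousPolynomial (m + 2) (fun x => f x ^ 2 * g x ^ m) := by
  have := prod_linear (Matrix.vecCons f (Matrix.vecCons f (fun _ : Fin m => g)))
  simpa [Fin.prod_univ_succ, ← mul_assoc, ← sq] using this

lemma IsHomogeneousPolynomial.continuous {P : X → Y} (hP : IsHomogeneousPolynomial k P) :
    Continuous P := by
  obtain ⟨L, hL⟩ := hP
  rw [show P = fun x => L (fun _ => x) from funext hL]
  exact L.cont.comp (by fun_prop)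

lemma IsHomogeneousPolynomial.differentiable {P : X → Y} (hP : IsHomogeneousPolynomial k P) :
    Differentiable ℂ P := by
  obtain ⟨L, hL⟩ := hP
  rw [show P = fun x => L (fun _ => x) from funext hL]
  have h1 : Differentiable ℂ (L : (Fin k → X) → Y) :=
    (L.contDiff (n := 1)).differentiable (by simp)
  exact h1.comp (differentiable_pi.2 fun _ => differentiable_id)

lemma IsHomogeneousPolynomial.map_smul {P : X → Y} (hP : IsHomogeneousPolynomial k P) (c : ℂ)
    (x : X) : P (c • x) = c ^ k • P x := by
  obtain ⟨L, hL⟩ := hP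
  rw [hL, hL, L.map_smul_univ (fun _ => c) (fun _ => x)]
  simp

lemma IsHomogeneousPolynomial.isPolynomial {P : X → Y} (hP : IsHomogeneousPolynomial k P) :
    IsPolynomial P := by
  refine ⟨k + 1, fun j => if j = k then P else fun _ => 0, fun j => ?_, fun x => ?_⟩
  · by_cases h : j = k
    · subst h; simpa using hP
    · simpa [h] using IsHomogeneousPolynomial.zero
  · rw [Finset.sum_eq_single k] <;> simp +contextual

lemma IsPolynomial.differentiable {P : X → Y} (hP : IsPolynomial P) : Differentiable ℂ P := by
  obtain ⟨N, Q, hQ, h⟩ := hP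
  rw [show P = fun x => ∑ k ∈ Finset.range N, Q k x from funext h]
  exact Differentiable.fun_sum fun k _ => (hQ k).differentiable

end Homogeneous

/-! ### The ball norm, the numerical radius, and attainment by compactness. -/

section BallNorm

variable {X Y : Type*} [NormedAddCommGroup X] [NormedAddCommGroup Y]

instance nonempty_unitBall : Nonempty (Metric.closedBall (0 : X) 1) := ⟨⟨0, by simp⟩⟩

instance nonempty_unitSphere : Nonempty (Metric.sphere (0 : ℂ) 1) := ⟨⟨1, by simp⟩⟩

lemma ballNorm_le {f : X → Y} {M : ℝ} (h : ∀ x, ‖x‖ ≤ 1 → ‖f x‖ ≤ M) : ballNorm f ≤ M :=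
  ciSup_le fun x => h x (mem_closedBall_zero_iff.1 x.2)

lemma exists_norm_eq_ballNorm [ProperSpace X] {f : X → Y} (hf : Continuous f) :
    ∃ x, ‖x‖ ≤ 1 ∧ ‖f x‖ = ballNorm f ∧ ∀ z, ‖z‖ ≤ 1 → ‖f z‖ ≤ ‖f x‖ := by
  obtain ⟨x, hx, hmax⟩ := (isCompact_closedBall (0 : X) 1).exists_isMaxOn ⟨0, by simp⟩
    hf.norm.continuousOn
  have hz : ∀ z, ‖z‖ ≤ 1 → ‖f z‖ ≤ ‖f x‖ := fun z hz => hmax (mem_closedBall_zero_iff.2 hz)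
  refine ⟨x, mem_closedBall_zero_iff.1 hx, le_antisymm ?_ (ballNorm_le hz), hz⟩
  exact le_ciSup (f := fun x : Metric.closedBall (0 : X) 1 => ‖f x‖)
    ⟨‖f x‖, by rintro _ ⟨z, rfl⟩; exact hz z (mem_closedBall_zero_iff.1 z.2)⟩ ⟨x, hx⟩

lemma norm_le_ballNorm [ProperSpace X] {f : X → Y} (hf : Continuous f) {x : X} (hx : ‖x‖ ≤ 1) :
    ‖f x‖ ≤ ballNorm f := by
  obtain ⟨z, _, h1, h2⟩ := exists_norm_eq_ballNorm hf
  exact h1 ▸ h2 x hx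

lemma ballNorm_eq [ProperSpace X] {f : X → Y} (hf : Continuous f) {M : ℝ}
    (h : ∀ x, ‖x‖ ≤ 1 → ‖f x‖ ≤ M) {x : X} (hx : ‖x‖ ≤ 1) (hfx : M ≤ ‖f x‖) : ballNorm f = M :=
  le_antisymm (ballNorm_le h) (hfx.trans (norm_le_ballNorm hf hx))

variable [NormedSpace ℂ X]

lemma numericalRadius_nonneg (f : X → X) : 0 ≤ numericalRadius f :=
  Real.sSup_nonneg (by rintro _ ⟨x, φ, -, -, -, rfl⟩; exact norm_nonneg _)

/-- For a unimodular `z`, any `w` is rotated by a unimodular factor to a nonnegative multiple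
of `z`. -/
lemma exists_rotation (w : ℂ) {z : ℂ} (hz : ‖z‖ = 1) : ∃ ω : ℂ, ‖ω‖ = 1 ∧ ω * w = ‖w‖ * z := by
  by_cases hw : w = 0
  · exact ⟨1, by simp, by simp [hw]⟩
  · exact ⟨‖w‖ * z / w, by simp [hz, hw], by field_simp⟩

/-- Numerical radius and alternative Daugavet norm: `1 + v(f) ≤ sup ‖x + ω f(x)‖`. -/
lemma one_add_numericalRadius_le {f : X → X} {M : ℝ} (hv : 0 < numericalRadius f)
    (h : ∀ (ω : ℂ) (x : X), ‖ω‖ = 1 → ‖x‖ ≤ 1 → ‖x + ω • f x‖ ≤ M) :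
    1 + numericalRadius f ≤ M := by
  rw [← le_sub_iff_add_le']
  refine csSup_le ?_ ?_
  -- In `ℝ`, `sSup ∅ = 0`, so a positive numerical radius excludes the empty set.
  · by_contra hne
    rw [Set.not_nonempty_iff_eq_empty] at hne
    rw [numericalRadius, hne, Real.sSup_empty] at hv
    exact hv.false
  · rintro _ ⟨x, φ, hx, hφ, hφx, rfl⟩
    obtain ⟨ω, hω, hωf⟩ := exists_rotation (φ (f x)) (z := 1) norm_one
    have h1 : φ (x + ω • f x) = ((1 + ‖φ (f x)‖ : ℝ) : ℂ) := by
      rw [map_add, map_smul, hφx, smul_eq_mul, hωf]; simp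
    have h2 := φ.le_opNorm (x + ω • f x)
    rw [h1, hφ, one_mul, Complex.norm_real, Real.norm_of_nonneg (by positivity)] at h2
    linarith [h ω x hω hx.le]

lemma exists_two_le_norm_add_smul [ProperSpace X] {f : X → X} (hf : Continuous f)
    (h : ∀ M, (∀ (ω : ℂ) (x : X), ‖ω‖ = 1 → ‖x‖ ≤ 1 → ‖x + ω • f x‖ ≤ M) → 2 ≤ M) :
    ∃ (ω : ℂ) (x : X), ‖ω‖ = 1 ∧ ‖x‖ ≤ 1 ∧ 2 ≤ ‖x + ω • f x‖ := by
  obtain ⟨⟨ω, x⟩, ⟨hω, hx⟩, hmax⟩ := ((isCompact_sphere (0 : ℂ) 1).prod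
    (isCompact_closedBall (0 : X) 1)).exists_isMaxOn ⟨(1, 0), by simp⟩
    (f := fun q : ℂ × X => ‖q.2 + q.1 • f q.2‖) (by fun_prop)
  refine ⟨ω, x, mem_sphere_zero_iff_norm.1 hω, mem_closedBall_zero_iff.1 hx, h _ ?_⟩
  intro ω' x' hω' hx'
  exact hmax (a := (ω', x')) ⟨mem_sphere_zero_iff_norm.2 hω', mem_closedBall_zero_iff.2 hx'⟩

end BallNorm

/-! ### From each polynomial property to the sup norm. -/

section PeakImpliesSup

variable {X : Type*} [NormedAddCommGroup X] [NormedSpace ℂ X] {n : ℕ}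
  {e : (Fin n → ℂ) ≃ₗ[ℂ] X}

/-- In degree at least two, an absolute norm admits a scalar homogeneous polynomial which peaks
on the unit ball exactly at the unimodular multiples of a vector with positive coordinates. -/
lemma IsAbsoluteNorm.exists_peak_polynomial (he : IsAbsoluteNorm e) (hn : 1 ≤ n) (m : ℕ) :
    ∃ u : Fin n → ℝ, (∀ i, 0 < u i) ∧ ‖e (fun i => (u i : ℂ))‖ ≤ 1 ∧
      ∃ p : X → ℂ, IsHomogeneousPolynomial (m + 2) p ∧ (∀ x, ‖x‖ ≤ 1 → ‖p x‖ ≤ 1) ∧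
        ‖p (e (fun i => (u i : ℂ)))‖ = 1 ∧
        ∀ x, ‖x‖ ≤ 1 → ‖p x‖ = 1 → ∃ ω : ℂ, ‖ω‖ = 1 ∧ x = ω • e (fun i => (u i : ℂ)) := by
  have : FiniteDimensional ℂ X := e.finiteDimensional
  obtain ⟨u, hu, hu1, hsupp⟩ := he.exists_extremal
  have hu0 : ∀ i, (u i : ℂ) ≠ 0 := fun i => by exact_mod_cast (hu i).ne'
  -- In coordinates rescaled by `u`, the vector `u` becomes `(1, …, 1)` and the unit ball lies in
  -- the `ℓ₁`-ball of radius `n`.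
  let ζ : Fin n → X →L[ℂ] ℂ := fun i =>
    LinearMap.toContinuousLinearMap ((u i : ℂ)⁻¹ • (LinearMap.proj i ∘ₗ e.symm.toLinearMap))
  have hζ : ∀ i x, ζ i x = (u i : ℂ)⁻¹ * e.symm x i := fun i x => rfl
  let s : X →L[ℂ] ℂ := ∑ i, ζ i
  have hs : ∀ x, s x = ∑ i, ζ i x := fun x => by simp [s]
  have hn' : (1 : ℝ) ≤ n := by exact_mod_cast hn
  -- The peak value at `(1, …, 1)`, used to normalize `p`.
  let C : ℝ := (2 * (n : ℝ) ^ 2 - n) * n ^ m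
  have hC0 : 0 < 2 * (n : ℝ) ^ 2 - n := by nlinarith
  have hC : 0 < C := by positivity
  have hball : ∀ x, ‖x‖ ≤ 1 → ∑ i, ‖ζ i x‖ ≤ n := fun x hx => by
    refine le_trans (Finset.sum_le_sum fun i _ => ?_) (hsupp (e.symm x) (by simpa using hx))
    rw [hζ, norm_mul, norm_inv, Complex.norm_real, Real.norm_of_nonneg (hu i).le, inv_mul_eq_div]
  let p : X → ℂ := fun x => (C : ℂ)⁻¹ •
    ((2 : ℂ) • (s x ^ 2 * s x ^ m) + (-1 : ℂ) • ∑ i, ζ i x ^ 2 * s x ^ m)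
  have hp : ∀ x, ‖p x‖ =
      C⁻¹ * (‖2 * (∑ i, ζ i x) ^ 2 - ∑ i, ζ i x ^ 2‖ * ‖∑ i, ζ i x‖ ^ m) := fun x => by
    have : p x = (C : ℂ)⁻¹ *
        ((2 * (∑ i, ζ i x) ^ 2 - ∑ i, ζ i x ^ 2) * (∑ i, ζ i x) ^ m) := by
      simp only [p, smul_eq_mul, hs, ← Finset.sum_mul]; ring
    rw [this, norm_mul, norm_mul, norm_pow, norm_inv, Complex.norm_real,
      Real.norm_of_nonneg hC.le]
  refine ⟨u, hu, hu1, p, ?_, fun x hx => ?_, ?_, fun x hx hpx => ?_⟩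
  · exact (((IsHomogeneousPolynomial.mul_pow s s).const_smul 2).add
      ((IsHomogeneousPolynomial.sum _ fun i =>
        IsHomogeneousPolynomial.mul_pow (ζ i) s).const_smul (-1))).const_smul _
  · rw [hp, inv_mul_le_one₀ hC]
    refine mul_le_mul (norm_quadratic_le_const hn _ (hball x hx)) ?_ (by positivity) hC0.le
    exact pow_le_pow_left₀ (norm_nonneg _) ((norm_sum_le _ _).trans (hball x hx)) m
  · have hone : ∀ i, ζ i (e (fun i => (u i : ℂ))) = 1 := fun i => by simp [hζ, hu0 i]
    rw [hp]
    simp only [hone]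
    have h1 : (2 * (∑ _i : Fin n, (1 : ℂ)) ^ 2 - ∑ _i : Fin n, (1 : ℂ) ^ 2) =
        ((2 * (n : ℝ) ^ 2 - n : ℝ) : ℂ) := by simp
    rw [h1, Complex.norm_real, Real.norm_of_nonneg hC0.le]
    simp only [Finset.sum_const, Finset.card_univ, Fintype.card_fin, nsmul_eq_mul, mul_one,
      Complex.norm_natCast]
    exact inv_mul_cancel₀ hC.ne'
  · rw [hp, inv_mul_eq_one₀ hC.ne'] at hpx
    obtain ⟨ω, hω, hz⟩ := eq_const_of_quadratic_peak hn m _ (hball x hx) hpx.symm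
    refine ⟨ω, hω, ?_⟩
    rw [← map_smul, ← e.symm_apply_eq]
    ext i
    have := hz i
    rw [hζ, inv_mul_eq_iff_eq_mul₀ (hu0 i)] at this
    rw [this]
    simp [mul_comm]

/-- If every normalized rank-one `k`-homogeneous polynomial (`k ≥ 2`) attains the alternative
Daugavet norm, then the absolute norm is the sup norm. -/
lemma IsAbsoluteNorm.norm_eq_of_alternative (he : IsAbsoluteNorm e) (hn : 1 ≤ n) {k : ℕ}
    (hk : 2 ≤ k)
    (H : ∀ (p : X → ℂ) (y : X), IsHomogeneousPolynomial k p →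
      ballNorm (fun x => p x • y) = 1 →
      ∃ (ω : ℂ) (x : X), ‖ω‖ = 1 ∧ ‖x‖ ≤ 1 ∧ 2 ≤ ‖x + ω • p x • y‖) (a : Fin n → ℂ) :
    ‖e a‖ = ‖a‖ := by
  have : FiniteDimensional ℂ X := e.finiteDimensional
  have : ProperSpace X := FiniteDimensional.proper ℂ X
  obtain ⟨m, rfl⟩ := Nat.exists_eq_add_of_le' hk
  obtain ⟨u, hu, hu1, p, hp, hple, hpu, hpeak⟩ := he.exists_peak_polynomial hn m
  refine he.norm_eq_of_norm_one_le (he.norm_one_le_of_positive hn hu hu1 fun y hy => ?_) a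
  obtain ⟨ω, x, hω, hx, h2⟩ := H p y hp (ballNorm_eq (hp.smul_const y).continuous
    (fun x hx => by simpa [norm_smul, hy] using hple x hx) hu1 (by simp [norm_smul, hy, hpu]))
  have h3 := h2.trans (norm_add_le _ _)
  rw [norm_smul, norm_smul, hω, hy, one_mul, mul_one] at h3
  have hpx : ‖p x‖ = 1 := le_antisymm (hple x hx) (by linarith)
  obtain ⟨θ, hθ, hxθ⟩ := hpeak x hx hpx
  have hθ0 : θ ≠ 0 := by rintro rfl; simp at hθ
  refine ⟨θ⁻¹ * (ω * p x), by simp [hθ, hω, hpx], ?_⟩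
  have h4 : x + ω • p x • y =
      θ • (e (fun i => (u i : ℂ)) + (θ⁻¹ * (ω * p x)) • y) := by
    rw [smul_add, ← hxθ, smul_smul θ, mul_inv_cancel_left₀ hθ0, mul_smul]
  rwa [h4, norm_smul, hθ, one_mul] at h2

lemma AlternativePDaugavetProperty.norm_eq (he : IsAbsoluteNorm e) (hn : 1 ≤ n)
    (h : AlternativePDaugavetProperty X) (a : Fin n → ℂ) : ‖e a‖ = ‖a‖ := by
  have : FiniteDimensional ℂ X := e.finiteDimensional
  have : ProperSpace X := FiniteDimensional.proper ℂ X
  refine he.norm_eq_of_alternative hn le_rfl (fun p y hp h1 => ?_) a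
  have hP := hp.smul_const y
  refine exists_two_le_norm_add_smul hP.continuous fun M hM => ?_
  have hw : IsWeaklyCompactMap (fun x => p x • y) := by
    have hc : IsCompact (toWeakSpace ℂ X '' ((fun x => p x • y) '' Metric.closedBall (0 : X) 1)) :=
      ((isCompact_closedBall (0 : X) 1).image hP.continuous).image
        (toWeakSpaceCLM ℂ X).continuous
    exact hc.closure
  have := h _ hP.isPolynomial hw
  rw [AlternativeDaugavetEquation, h1] at this
  have h2 : (⨆ ω : Metric.sphere (0 : ℂ) 1, ballNorm (fun x => x + (ω : ℂ) • p x • y)) ≤ M :=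
    ciSup_le fun ω => ballNorm_le fun x hx => hM ω x (mem_sphere_zero_iff_norm.1 ω.2) hx
  linarith

lemma OrderDaugavetProperty.norm_eq (he : IsAbsoluteNorm e) (hn : 1 ≤ n) {k : ℕ} (hk : 2 ≤ k)
    (h : OrderDaugavetProperty X k) (a : Fin n → ℂ) : ‖e a‖ = ‖a‖ := by
  have : FiniteDimensional ℂ X := e.finiteDimensional
  have : ProperSpace X := FiniteDimensional.proper ℂ X
  refine he.norm_eq_of_alternative hn hk (fun p y hp h1 => ?_) a
  have hD : ballNorm (fun x => x + p x • y) = 1 + ballNorm (fun x => p x • y) := h p y hp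
  obtain ⟨x, hx, hxb, -⟩ :=
    exists_norm_eq_ballNorm (continuous_id.add (hp.smul_const y).continuous)
  refine ⟨1, x, norm_one, hx, ?_⟩
  have hxb' : ‖x + p x • y‖ = ballNorm (fun x => x + p x • y) := hxb
  rw [one_smul, hxb', hD, h1]
  norm_num

lemma exists_two_le_of_numericalRadius [ProperSpace X] {f : X → X} (hf : Continuous f)
    (h : 1 ≤ numericalRadius f) :
    ∃ (ω : ℂ) (x : X), ‖ω‖ = 1 ∧ ‖x‖ ≤ 1 ∧ 2 ≤ ‖x + ω • f x‖ :=
  exists_two_le_norm_add_smul hf fun M hM => by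
    linarith [one_add_numericalRadius_le (zero_lt_one.trans_le h) hM]

lemma norm_eq_of_polynomialNumericalIndex (he : IsAbsoluteNorm e) (hn : 1 ≤ n) {k : ℕ}
    (hk : 2 ≤ k) (h : polynomialNumericalIndex X k = 1) (a : Fin n → ℂ) : ‖e a‖ = ‖a‖ := by
  have : FiniteDimensional ℂ X := e.finiteDimensional
  have : ProperSpace X := FiniteDimensional.proper ℂ X
  refine he.norm_eq_of_alternative hn hk (fun p y hp h1 => ?_) a
  have hP := hp.smul_const y
  refine exists_two_le_of_numericalRadius hP.continuous (h ▸ csInf_le ⟨0, ?_⟩ ⟨_, hP, h1, rfl⟩)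
  rintro _ ⟨P, -, -, rfl⟩
  exact numericalRadius_nonneg P

lemma norm_eq_of_analyticNumericalIndex (he : IsAbsoluteNorm e) (hn : 1 ≤ n)
    (h : analyticNumericalIndex X = 1) (a : Fin n → ℂ) : ‖e a‖ = ‖a‖ := by
  have : FiniteDimensional ℂ X := e.finiteDimensional
  have : ProperSpace X := FiniteDimensional.proper ℂ X
  refine he.norm_eq_of_alternative hn le_rfl (fun p y hp h1 => ?_) a
  have hP := hp.smul_const y
  refine exists_two_le_of_numericalRadius hP.continuous
    (h ▸ csInf_le ⟨0, ?_⟩ ⟨_, hP.isPolynomial, h1, rfl⟩)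
  rintro _ ⟨P, -, -, rfl⟩
  exact numericalRadius_nonneg P

end PeakImpliesSup

/-! ### Polynomials on `ℓ_∞^n` via the maximum modulus principle. -/

section SupNorm

variable {X : Type*} [NormedAddCommGroup X] [NormedSpace ℂ X] {n : ℕ}

lemma exists_norm_coord_eq (hn : 1 ≤ n) (a : Fin n → ℂ) : ∃ j, ‖a j‖ = ‖a‖ := by
  have : Nonempty (Fin n) := ⟨⟨0, hn⟩⟩
  obtain ⟨j, hj⟩ := Finite.exists_max fun i => ‖a i‖
  exact ⟨j, le_antisymm (norm_le_pi_norm a j)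
    ((pi_norm_le_iff_of_nonneg (norm_nonneg _)).2 hj)⟩

lemma norm_coord_le (T : X ≃ₗᵢ[ℂ] (Fin n → ℂ)) (x : X) (j : Fin n) : ‖T x j‖ ≤ ‖x‖ :=
  (norm_le_pi_norm (T x) j).trans (T.norm_map x).le

/-- Maximum modulus principle in the `j`-th coordinate: an entire function attains its maximum
modulus over the polydisc at a point whose `j`-th coordinate is unimodular. -/
lemma exists_max_norm_coord_eq_one (T : X ≃ₗᵢ[ℂ] (Fin n → ℂ)) (j : Fin n) {f : X → ℂ}
    (hf : Differentiable ℂ f) :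
    ∃ x, ‖x‖ ≤ 1 ∧ ‖T x j‖ = 1 ∧ ∀ z, ‖z‖ ≤ 1 → ‖f z‖ ≤ ‖f x‖ := by
  have : FiniteDimensional ℂ X := T.symm.toLinearEquiv.finiteDimensional
  have : ProperSpace X := FiniteDimensional.proper ℂ X
  obtain ⟨z, hz, -, hmax⟩ := exists_norm_eq_ballNorm hf.continuous
  -- The disc through the maximizer `z` along which only the `j`-th coordinate varies.
  let b : ℂ → X := fun c => T.symm (Function.update (T z) j 0) + c • T.symm (Pi.single j 1)
  have hb : ∀ c, T (b c) = Function.update (T z) j c := fun c => by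
    ext i
    by_cases h : i = j
    · subst h; simp [b]
    · simp [b, h]
  have hg : Differentiable ℂ (fun c => f (b c)) := hf.comp (by fun_prop)
  obtain ⟨c, hc, hcmax⟩ := Complex.exists_mem_frontier_isMaxOn_norm
    (Metric.isBounded_ball (x := (0 : ℂ)) (r := 1)) (by simp) hg.diffContOnCl
  rw [frontier_ball _ one_ne_zero, mem_sphere_zero_iff_norm] at hc
  rw [closure_ball _ one_ne_zero] at hcmax
  refine ⟨b c, ?_, by rw [hb]; simp [hc], fun w hw => (hmax w hw).trans ?_⟩
  · rw [← T.norm_map, hb, pi_norm_le_iff_of_nonneg zero_le_one]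
    intro i
    by_cases h : i = j
    · subst h; simp [hc]
    · simpa [h] using (norm_coord_le T z i).trans hz
  · have hz' : b (T z j) = z := T.injective (by rw [hb, Function.update_eq_self])
    have := hcmax (mem_closedBall_zero_iff.2 ((norm_coord_le T z j).trans hz))
    simpa [hz'] using this

lemma exists_coord_eq_ballNorm (T : X ≃ₗᵢ[ℂ] (Fin n → ℂ)) (hn : 1 ≤ n) {P : X → X}
    (hP : Differentiable ℂ P) :
    ∃ (j : Fin n) (x : X), ‖x‖ ≤ 1 ∧ ‖T x j‖ = 1 ∧ ‖T (P x) j‖ = ballNorm P := by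
  have : FiniteDimensional ℂ X := T.symm.toLinearEquiv.finiteDimensional
  have : ProperSpace X := FiniteDimensional.proper ℂ X
  obtain ⟨z, hz, hzP, -⟩ := exists_norm_eq_ballNorm hP.continuous
  obtain ⟨j, hj⟩ := exists_norm_coord_eq hn (T (P z))
  have hd : Differentiable ℂ (fun x => T (P x) j) :=
    differentiable_pi.1 (T.toContinuousLinearEquiv.differentiable.comp hP) j
  obtain ⟨x, hx, hxj, hmax⟩ := exists_max_norm_coord_eq_one T j hd
  refine ⟨j, x, hx, hxj, le_antisymm ?_ ?_⟩
  · exact (norm_coord_le T _ j).trans (norm_le_ballNorm hP.continuous hx)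
  · rw [← hzP, ← T.norm_map, ← hj]
    exact hmax z hz

lemma AlternativeDaugavetEquation.of_supNorm (T : X ≃ₗᵢ[ℂ] (Fin n → ℂ)) (hn : 1 ≤ n) {P : X → X}
    (hP : Differentiable ℂ P) : AlternativeDaugavetEquation P := by
  have : FiniteDimensional ℂ X := T.symm.toLinearEquiv.finiteDimensional
  have : ProperSpace X := FiniteDimensional.proper ℂ X
  have hPc := hP.continuous
  have hle : ∀ ω : Metric.sphere (0 : ℂ) 1,
      ballNorm (fun x => x + (ω : ℂ) • P x) ≤ 1 + ballNorm P := fun ω =>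
    ballNorm_le fun x hx => by
      refine (norm_add_le _ _).trans (add_le_add hx ?_)
      rw [norm_smul, mem_sphere_zero_iff_norm.1 ω.2, one_mul]
      exact norm_le_ballNorm hPc hx
  refine le_antisymm (ciSup_le hle) ?_
  obtain ⟨j, x, hx, hxj, hPj⟩ := exists_coord_eq_ballNorm T hn hP
  -- Aligns the `j`-th coordinates of `ωP(x)` and `x`, so that their moduli add.
  obtain ⟨ω, hω, hωP⟩ := exists_rotation (T (P x) j) hxj
  refine le_trans ?_ (le_ciSup (f := fun ω : Metric.sphere (0 : ℂ) 1 =>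
    ballNorm (fun x => x + (ω : ℂ) • P x)) ⟨_, by rintro _ ⟨ω, rfl⟩; exact hle ω⟩
    ⟨ω, mem_sphere_zero_iff_norm.2 hω⟩)
  have h1 : T (x + ω • P x) j = ((1 + ballNorm P : ℝ) : ℂ) * T x j := by
    rw [map_add, map_smul, Pi.add_apply, Pi.smul_apply, smul_eq_mul, hωP, hPj]
    push_cast; ring
  have h2 : ‖T (x + ω • P x) j‖ = 1 + ballNorm P := by
    rw [h1, norm_mul, hxj, mul_one, Complex.norm_real, Real.norm_of_nonneg]
    rw [← hPj]; positivity
  rw [← h2]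
  exact (norm_coord_le T _ j).trans
    (norm_le_ballNorm (f := fun x => x + ω • P x) (by fun_prop) hx)

lemma numericalRadius_eq_ballNorm (T : X ≃ₗᵢ[ℂ] (Fin n → ℂ)) (hn : 1 ≤ n) {P : X → X}
    (hP : Differentiable ℂ P) : numericalRadius P = ballNorm P := by
  have : FiniteDimensional ℂ X := T.symm.toLinearEquiv.finiteDimensional
  have : ProperSpace X := FiniteDimensional.proper ℂ X
  obtain ⟨j, x, hx, hxj, hPj⟩ := exists_coord_eq_ballNorm T hn hP
  -- The `j`-th coordinate, rotated to take the value 1 at `x`; it supports the ball there and sees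
  -- all of `‖P‖`.
  let φ : X →L[ℂ] ℂ := (starRingEnd ℂ (T x j)) •
    ((ContinuousLinearMap.proj j).comp (T.toContinuousLinearEquiv : X →L[ℂ] (Fin n → ℂ)))
  have hφ : ∀ z, φ z = starRingEnd ℂ (T x j) * T z j := fun z => rfl
  have hφn : ∀ z, ‖φ z‖ = ‖T z j‖ := fun z => by
    rw [hφ, norm_mul, RCLike.norm_conj, hxj, one_mul]
  have hφx : φ x = 1 := by
    rw [hφ, mul_comm, Complex.mul_conj, Complex.normSq_eq_norm_sq, hxj]; simp
  have hx1 : ‖x‖ = 1 := le_antisymm hx (hxj ▸ norm_coord_le T x j)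
  have hφ1 : ‖φ‖ = 1 := by
    refine le_antisymm (φ.opNorm_le_bound zero_le_one fun z => ?_) ?_
    · rw [hφn, one_mul]; exact norm_coord_le T z j
    · have := φ.le_opNorm x
      rwa [hφx, hx1, norm_one, mul_one] at this
  have hub : ∀ r ∈ {r : ℝ | ∃ (x : X) (φ : X →L[ℂ] ℂ), ‖x‖ = 1 ∧ ‖φ‖ = 1 ∧ φ x = 1 ∧
      r = ‖φ (P x)‖}, r ≤ ballNorm P := by
    rintro _ ⟨z, ψ, hz, hψ, -, rfl⟩
    refine (ψ.le_opNorm _).trans ?_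
    rw [hψ, one_mul]
    exact norm_le_ballNorm hP.continuous hz.le
  have hmem : ballNorm P ∈ {r : ℝ | ∃ (x : X) (φ : X →L[ℂ] ℂ), ‖x‖ = 1 ∧ ‖φ‖ = 1 ∧ φ x = 1 ∧
      r = ‖φ (P x)‖} := ⟨x, φ, hx1, hφ1, hφx, by rw [hφn, hPj]⟩
  exact le_antisymm (csSup_le ⟨_, hmem⟩ hub) (le_csSup ⟨_, hub⟩ hmem)

lemma OrderDaugavetProperty.of_supNorm (T : X ≃ₗᵢ[ℂ] (Fin n → ℂ)) (hn : 1 ≤ n) {k : ℕ}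
    (hk : 2 ≤ k) : OrderDaugavetProperty X k := by
  have : FiniteDimensional ℂ X := T.symm.toLinearEquiv.finiteDimensional
  have : ProperSpace X := FiniteDimensional.proper ℂ X
  intro p y hp
  have hpc := hp.continuous
  obtain ⟨m, rfl⟩ := Nat.exists_eq_add_of_le' hk
  obtain ⟨j, hj⟩ := exists_norm_coord_eq hn (T y)
  rw [T.norm_map] at hj
  obtain ⟨x, hx, hxj, hmax⟩ := exists_max_norm_coord_eq_one T j hp.differentiable
  have hB : ballNorm (fun x => p x • y) = ‖p x‖ * ‖y‖ :=
    ballNorm_eq (by fun_prop) (fun z hz => by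
      rw [norm_smul]; exact mul_le_mul_of_nonneg_right (hmax z hz) (norm_nonneg _)) hx
      (norm_smul _ _).ge
  obtain ⟨c, hc, hcp⟩ := exists_rotation (p x * T y j) hxj
  -- No free scalar `ω` is available here. Replacing `x` by `θx` turns `p(x)y` by `θ^(m+1)` relative
  -- to `x`, and `m + 1 ≥ 1`, so a root of `c` aligns them.
  obtain ⟨θ, hθ⟩ := IsAlgClosed.exists_pow_nat_eq c (Nat.succ_pos m)
  have hθ1 : ‖θ‖ = 1 := by
    rw [← pow_eq_one_iff_of_nonneg (norm_nonneg _) (Nat.succ_ne_zero m), ← norm_pow, hθ, hc]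
  rw [DaugavetEquation, hB]
  refine ballNorm_eq (x := θ • x) (by fun_prop) (fun z hz => ?_)
    (by rwa [norm_smul, hθ1, one_mul]) ?_
  · refine (norm_add_le _ _).trans (add_le_add hz ?_)
    rw [norm_smul]
    exact mul_le_mul_of_nonneg_right (hmax z hz) (norm_nonneg _)
  · have h1 : T (θ • x + p (θ • x) • y) j = θ * (((1 + ‖p x‖ * ‖y‖ : ℝ) : ℂ) * T x j) := by
      have h2 : T (θ • x + p (θ • x) • y) j = θ * (T x j + θ ^ (m + 1) * (p x * T y j)) := by
        rw [hp.map_smul]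
        simp only [map_add, _root_.map_smul, Pi.add_apply, Pi.smul_apply, smul_eq_mul]
        ring
      rw [h2, hθ, hcp, norm_mul, hj]
      push_cast; ring
    refine le_trans (le_of_eq ?_) (norm_coord_le T _ j)
    rw [h1, norm_mul, norm_mul, hθ1, hxj, Complex.norm_real, Real.norm_of_nonneg (by positivity)]
    ring

/-- Keeps the infima defining the indices from being `sInf ∅ = 0`. -/
lemma exists_homogeneousPolynomial_ballNorm_eq_one (T : X ≃ₗᵢ[ℂ] (Fin n → ℂ)) (hn : 1 ≤ n)
    (k : ℕ) : ∃ P : X → X, IsHomogeneousPolynomial k P ∧ ballNorm P = 1 := by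
  have : FiniteDimensional ℂ X := T.symm.toLinearEquiv.finiteDimensional
  have : ProperSpace X := FiniteDimensional.proper ℂ X
  let j : Fin n := ⟨0, hn⟩
  let y : X := T.symm (Pi.single j 1)
  have hy : ‖y‖ = 1 := by rw [T.symm.norm_map, Pi.norm_single, norm_one]
  have hP := (IsHomogeneousPolynomial.prod_linear (fun _ : Fin k =>
    (ContinuousLinearMap.proj (R := ℂ) (φ := fun _ : Fin n => ℂ) j).comp
      (T.toContinuousLinearEquiv : X →L[ℂ] (Fin n → ℂ)))).smul_const y
  refine ⟨_, hP, ballNorm_eq hP.continuous (fun x hx => ?_) hy.le ?_⟩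
  · simpa [norm_smul, hy] using pow_le_one₀ (norm_nonneg _) ((norm_coord_le T x j).trans hx)
  · simp [y, Pi.norm_single]

lemma polynomialNumericalIndex_eq_one (T : X ≃ₗᵢ[ℂ] (Fin n → ℂ)) (hn : 1 ≤ n) (k : ℕ) :
    polynomialNumericalIndex X k = 1 := by
  obtain ⟨P, hP, hP1⟩ := exists_homogeneousPolynomial_ballNorm_eq_one T hn k
  have : {r : ℝ | ∃ P : X → X, IsHomogeneousPolynomial k P ∧ ballNorm P = 1 ∧
      r = numericalRadius P} = {1} := by
    refine Set.eq_singleton_iff_unique_mem.2 ⟨⟨P, hP, hP1, ?_⟩, ?_⟩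
    · rw [numericalRadius_eq_ballNorm T hn hP.differentiable, hP1]
    · rintro _ ⟨Q, hQ, hQ1, rfl⟩
      rw [numericalRadius_eq_ballNorm T hn hQ.differentiable, hQ1]
  rw [polynomialNumericalIndex, this, csInf_singleton]

lemma analyticNumericalIndex_eq_one (T : X ≃ₗᵢ[ℂ] (Fin n → ℂ)) (hn : 1 ≤ n) :
    analyticNumericalIndex X = 1 := by
  obtain ⟨P, hP, hP1⟩ := exists_homogeneousPolynomial_ballNorm_eq_one T hn 1
  have : {r : ℝ | ∃ P : X → X, IsPolynomial P ∧ ballNorm P = 1 ∧ r = numericalRadius P} = {1} := by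
    refine Set.eq_singleton_iff_unique_mem.2 ⟨⟨P, hP.isPolynomial, hP1, ?_⟩, ?_⟩
    · rw [numericalRadius_eq_ballNorm T hn hP.differentiable, hP1]
    · rintro _ ⟨Q, hQ, hQ1, rfl⟩
      rw [numericalRadius_eq_ballNorm T hn hQ.differentiable, hQ1]
  rw [analyticNumericalIndex, this, csInf_singleton]

end SupNorm

end PolyDaugavet

/-! ### The equivalence. -/

theorem mainTheorem7 {X : Type*} [NormedAddCommGroup X] [NormedSpace ℂ X]
    {n : ℕ} (hn : 1 ≤ n) (e : (Fin n → ℂ) ≃ₗ[ℂ] X) (he : PolyDaugavet.IsAbsoluteNorm e) :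
    List.TFAE [
      PolyDaugavet.AlternativePDaugavetProperty X,
      ∃ k : ℕ, 2 ≤ k ∧ PolyDaugavet.OrderDaugavetProperty X k,
      ∀ k : ℕ, 2 ≤ k → PolyDaugavet.OrderDaugavetProperty X k,
      ∃ k : ℕ, 2 ≤ k ∧ PolyDaugavet.polynomialNumericalIndex X k = 1,
      ∀ k : ℕ, 2 ≤ k → PolyDaugavet.polynomialNumericalIndex X k = 1,
      PolyDaugavet.analyticNumericalIndex X = 1,
      ∀ a : Fin n → ℂ, ‖e a‖ = ‖a‖,
      Nonempty (X ≃ₗᵢ[ℂ] (Fin n → ℂ))] := by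
  tfae_have 1 → 7 := fun h => h.norm_eq he hn
  tfae_have 2 → 7 := fun ⟨_, hk, h⟩ => h.norm_eq he hn hk
  tfae_have 4 → 7 := fun ⟨_, hk, h⟩ => PolyDaugavet.norm_eq_of_polynomialNumericalIndex he hn hk h
  tfae_have 6 → 7 := fun h => PolyDaugavet.norm_eq_of_analyticNumericalIndex he hn h
  tfae_have 7 → 8 := fun h => ⟨(LinearIsometryEquiv.mk e h).symm⟩
  tfae_have 8 → 1 := fun ⟨T⟩ _ hP _ =>
    PolyDaugavet.AlternativeDaugavetEquation.of_supNorm T hn hP.differentiable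
  tfae_have 8 → 3 := fun ⟨T⟩ _ hk => PolyDaugavet.OrderDaugavetProperty.of_supNorm T hn hk
  tfae_have 8 → 5 := fun ⟨T⟩ k _ => PolyDaugavet.polynomialNumericalIndex_eq_one T hn k
  tfae_have 8 → 6 := fun ⟨T⟩ => PolyDaugavet.analyticNumericalIndex_eq_one T hn
  tfae_have 3 → 2 := fun h => ⟨2, le_rfl, h 2 le_rfl⟩
  tfae_have 5 → 4 := fun h => ⟨2, le_rfl, h 2 le_rfl⟩
  tfae_finish
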